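/- **Setting.** Let $\Omega\subset\mathbb R^3$ be open with a tetrahedral mesh $\mathcal T$ (finitely many nondegenerate closed tetrahedra with pairwise disjoint interiors and union $\overline\Omega$). For $r\ge 0$ let $S=\{\varphi\in C(\overline\Omega):\varphi|_\tau\in P_r\ \forall\tau\in\mathcal T,\ \varphi|_{\partial\Omega}=0\}$ be the Lagrange finite element space with the $L^2(\Omega)$ inner product $(\cdot,\cdot)$, its functions being extended by zero. For $U=(u_1,\dots,u_N)$ and $V=(v_1,\dots,v_N)$ in $S^N$ put $\langle U^TV\rangle=((u_i,v_j))_{i,j}$, $(U,V)=\operatorname{tr}\langle U^TV\rangle$, $|||U|||=(U,U)^{1/2}$, and $UP=(\sum_j p_{j1}u_j,\dots,\sum_j p_{jN}u_j)$ for $P\in\mathbb R^{N\times N}$. Let $\mathcal M=\{U\in S^N:\langle U^TU\rangle=I_N\}$, and let $B(U,\delta)$ be the closed $|||\cdot|||$-ball. For nuclei with charges $Z_j>0$ at distinct points $R_j$, an exchange-correlation energy per particle $\varepsilon_{xc}$ that is continuous on $[0,\infty)$, and $\rho=\sum_l|u_l|^2$, the Kohn–Sham energy is $$E(U)=\tfrac12\sum_{l}\int|\nabla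 u_l|^2-\int\sum_j\frac{Z_j}{|x-R_j|}\rho(x)\,dx+\tfrac12\iint\frac{\rho(x)\rho(y)}{|x-y|}\,dx\,dy+\int\varepsilon_{xc}(\rho)\rho\,dx+\sum_{j<k}\frac{Z_jZ_k}{|R_j-R_k|}.$$ $\nabla E(U)\in S^N$ denotes the gradient of $E$ on $S^N$ with respect to $(\cdot,\cdot)$, $\nabla_GE(U)=\nabla E(U)\langle U^TU\rangle-U\langle\nabla E(U)^TU\rangle^T$, and $\mathcal A_UV=\nabla E(U)\langle U^TV\rangle-U\langle\nabla E(U)^TV\rangle$. Assume that $E$ is differentiable at every point of $\mathcal M$ and that $\nabla E$ is Lipschitz continuous on $\mathcal M$. **Theorem.** Let $U^*\in\mathcal M$ be a local minimizer of $E$ on $\mathcal M$ that is an isolated critical point up to orthogonal transformations: there is $\delta_c>0$ such that every $V\in\mathcal M\cap B(U^*,\delta_c)$ with $\nabla_GE(V)=0$ has the form $V=U^*P$ with $P$ orthogonal. Then there are $\delta>0$ and $\delta_T>0$ such that for every $U^0\in\mathcal M\cap B(U^*,\delta)$ and all time steps $0<\Delta t_n\le\delta_T$ with $\sum_n\Delta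 t_n=\infty$, the linearized scheme $$\frac{U^{n+1}-U^n}{\Delta t_n}=-\mathcal A_{U^n}U^{n+1/2},\qquad U^{n+1/2}=\tfrac12(U^n+U^{n+1}),\qquad n\ge0,$$ has exactly one solution $(U^n)_{n\ge0}$ in $S^N$ starting at $U^0$, and it satisfies $$\lim_{n\to\infty}|||\nabla_GE(U^n)|||=0,\qquad\lim_{n\to\infty}E(U^n)=E(U^*).$$ -/

import Mathlib

open MeasureTheory Filter Topology Set
open scoped Gradient InnerProductSpace

noncomputable section

namespace KohnSham

/-- Physical space `ℝ³` with its Euclidean norm. -/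
abbrev E3 : Type := EuclideanSpace ℝ (Fin 3)

/-! ### Tetrahedral meshes and Lagrange finite element spaces -/

/-- The closed tetrahedron with vertices `v 0, v 1, v 2, v 3`. -/
def tetrahedron (v : Fin 4 → E3) : Set E3 := convexHull ℝ (range v)

/-- A tetrahedral mesh of `Ω`: finitely many nondegenerate, nonoverlapping closed tetrahedra
that completely cover `Ω`. -/
structure TetMesh (Ω : Set E3) where
  /-- the cells, each given by its four vertices -/
  cells : Finset (Fin 4 → E3)
  nondegenerate : ∀ v ∈ cells, AffineIndependent ℝ v
  nonoverlapping : ∀ v ∈ cells, ∀ w ∈ cells, v ≠ w →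
    Disjoint (interior (tetrahedron v)) (interior (tetrahedron w))
  covers : ⋃ v ∈ cells, tetrahedron v = closure Ω

variable {Ω : Set E3}

/-- The Lagrange finite element functions of degree `r`: continuous, polynomial of total degree
at most `r` on every cell, and zero on `∂Ω`; they are extended by zero outside `Ω`. -/
def feSubmodule (T : TetMesh Ω) (r : ℕ) : Submodule ℝ (E3 → ℝ) where
  carrier := {φ | Continuous φ ∧ (∀ x, x ∉ Ω → φ x = 0) ∧
    ∀ v ∈ T.cells, ∃ p : MvPolynomial (Fin 3) ℝ, p.totalDegree ≤ r ∧
      ∀ x ∈ tetrahedron v, φ x = MvPolynomial.eval (fun i => x i) p}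
  add_mem' := by
    rintro f g ⟨hf, hf0, hfp⟩ ⟨hg, hg0, hgp⟩
    refine ⟨hf.add hg, fun x hx => by simp [hf0 x hx, hg0 x hx], fun v hv => ?_⟩
    obtain ⟨p, hp, hpe⟩ := hfp v hv
    obtain ⟨q, hq, hqe⟩ := hgp v hv
    refine ⟨p + q, (MvPolynomial.totalDegree_add p q).trans (max_le hp hq), fun x hx => ?_⟩
    simp [hpe x hx, hqe x hx]
  zero_mem' := ⟨continuous_const, fun _ _ => rfl, fun _ _ => ⟨0, by simp, fun _ _ => by simp⟩⟩
  smul_mem' := by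
    rintro c f ⟨hf, hf0, hfp⟩
    refine ⟨hf.const_smul c, fun x hx => by simp [hf0 x hx], fun v hv => ?_⟩
    obtain ⟨p, hp, hpe⟩ := hfp v hv
    refine ⟨c • p, (MvPolynomial.totalDegree_smul_le c p).trans hp, fun x hx => ?_⟩
    simp [hpe x hx]

/-- The finite element space `S` as a type of its own, so that it can carry the `L²` inner
product. -/
def FESpace (T : TetMesh Ω) (r : ℕ) : Type := feSubmodule T r

namespace FESpace

variable {T : TetMesh Ω} {r : ℕ}

instance : AddCommGroup (FESpace T r) := inferInstanceAs (AddCommGroup (feSubmodule T r))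

instance : Module ℝ (FESpace T r) := inferInstanceAs (Module ℝ (feSubmodule T r))

/-- The underlying function `ℝ³ → ℝ` of a finite element function. -/
def toFun (u : FESpace T r) : E3 → ℝ := Subtype.val u

theorem continuous_toFun (u : FESpace T r) : Continuous u.toFun := u.2.1

theorem toFun_eq_zero (u : FESpace T r) {x : E3} (hx : x ∉ Ω) : u.toFun x = 0 := u.2.2.1 x hx

theorem toFun_add (u v : FESpace T r) : (u + v).toFun = u.toFun + v.toFun := rfl

theorem toFun_smul (c : ℝ) (u : FESpace T r) : (c • u).toFun = c • u.toFun := rfl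

theorem toFun_injective : Function.Injective (toFun : FESpace T r → E3 → ℝ) :=
  Subtype.val_injective

theorem isCompact_closure (T : TetMesh Ω) : IsCompact (closure Ω) := by
  rw [← T.covers]
  exact T.cells.isCompact_biUnion fun v _ => (Set.finite_range v).isCompact_convexHull ℝ

theorem hasCompactSupport (u : FESpace T r) : HasCompactSupport u.toFun :=
  HasCompactSupport.intro (isCompact_closure T) fun _ hx =>
    u.toFun_eq_zero fun h => hx (subset_closure h)

theorem integrable_mul (u v : FESpace T r) : Integrable (fun x => u.toFun x * v.toFun x) :=
  (u.continuous_toFun.mul v.continuous_toFun).integrable_of_hasCompactSupport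
    (HasCompactSupport.mul_right u.hasCompactSupport)

theorem setIntegral_mul (u v : FESpace T r) :
    ∫ x in Ω, u.toFun x * v.toFun x = ∫ x, u.toFun x * v.toFun x :=
  setIntegral_eq_integral_of_forall_compl_eq_zero fun x hx => by simp [u.toFun_eq_zero hx]

/-- The `L²(Ω)` inner product on the finite element space. -/
abbrev l2Core : InnerProductSpace.Core ℝ (FESpace T r) where
  inner u v := ∫ x in Ω, u.toFun x * v.toFun x
  conj_inner_symm u v := by simp [mul_comm]
  re_inner_nonneg u := by
    simpa using integral_nonneg fun x => mul_self_nonneg (u.toFun x)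
  add_left u v w := by
    simp only [setIntegral_mul]
    simp only [toFun_add, Pi.add_apply, add_mul]
    exact integral_add (integrable_mul u w) (integrable_mul v w)
  smul_left u v c := by
    simp only [toFun_smul, Pi.smul_apply, smul_eq_mul, mul_assoc,
      integral_const_mul, conj_trivial]
  definite u h := by
    have h1 : ∫ x, u.toFun x * u.toFun x = 0 := (setIntegral_mul u u).symm.trans h
    have h2 := (integral_eq_zero_iff_of_nonneg (fun x => mul_self_nonneg (u.toFun x))
      (integrable_mul u u)).1 h1
    have h3 := (Continuous.ae_eq_iff_eq (volume : Measure E3)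
      (u.continuous_toFun.mul u.continuous_toFun) continuous_const).1 h2
    apply toFun_injective
    funext x
    exact mul_self_eq_zero.1 (congrFun h3 x)

instance : NormedAddCommGroup (FESpace T r) :=
  @InnerProductSpace.Core.toNormedAddCommGroup ℝ (FESpace T r) _ _ _ l2Core

instance : InnerProductSpace ℝ (FESpace T r) := InnerProductSpace.ofCore l2Core.toCore

theorem inner_def (u v : FESpace T r) :
    inner ℝ u v = ∫ x in Ω, u.toFun x * v.toFun x := rfl

open Classical in
instance : FiniteDimensional ℝ (FESpace T r) := by
  let ev : (v : Fin 4 → E3) → MvPolynomial (Fin 3) ℝ →ₗ[ℝ] (E3 → ℝ) := fun v =>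
    { toFun := fun p x => if x ∈ tetrahedron v then MvPolynomial.eval (fun i => x i) p else 0
      map_add' := fun p q => by funext x; by_cases h : x ∈ tetrahedron v <;> simp [h]
      map_smul' := fun c p => by funext x; by_cases h : x ∈ tetrahedron v <;> simp [h] }
  let P : (Fin 4 → E3) → Submodule ℝ (E3 → ℝ) := fun v =>
    (MvPolynomial.restrictTotalDegree (Fin 3) ℝ r).map (ev v)
  let res : (v : T.cells) → FESpace T r →ₗ[ℝ] P v := fun v =>
    { toFun := fun u => ⟨fun x => if x ∈ tetrahedron v.1 then u.toFun x else 0, by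
        obtain ⟨p, hp, hpe⟩ := u.2.2.2 v.1 v.2
        refine ⟨p, (MvPolynomial.mem_restrictTotalDegree _ _ _).2 hp, ?_⟩
        funext x
        by_cases h : x ∈ tetrahedron v.1
        · simp only [ev, LinearMap.coe_mk, AddHom.coe_mk, h, if_true]
          exact (hpe x h).symm
        · simp [ev, h]⟩
      map_add' := fun u w => by
        ext x; by_cases h : x ∈ tetrahedron v.1 <;> simp [h, toFun_add]
      map_smul' := fun c u => by
        ext x; by_cases h : x ∈ tetrahedron v.1 <;> simp [h, toFun_smul] }
  have : ∀ v, FiniteDimensional ℝ (P v) := fun v => inferInstance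
  refine FiniteDimensional.of_injective (LinearMap.pi res) fun u w huw => ?_
  apply toFun_injective
  funext x
  by_cases hx : x ∈ Ω
  · have hx' : x ∈ ⋃ v ∈ T.cells, tetrahedron v := by
      rw [T.covers]; exact subset_closure hx
    simp only [mem_iUnion] at hx'
    obtain ⟨v, hv, hxv⟩ := hx'
    have := congrFun (congrArg Subtype.val (congrFun huw ⟨v, hv⟩)) x
    simpa [res, hxv] using this
  · rw [u.toFun_eq_zero hx, w.toFun_eq_zero hx]

instance : CompleteSpace (FESpace T r) := FiniteDimensional.complete ℝ _

end FESpace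

/-- `S^N`: `N`-tuples `U = (u₁, …, u_N)` of finite element functions, with the inner product
`(U, V) = ∑ᵢ (uᵢ, vᵢ)_{L²} = tr ⟨Uᵀ V⟩` and the associated norm. -/
abbrev Orbitals (T : TetMesh Ω) (r N : ℕ) : Type := PiLp 2 fun _ : Fin N => FESpace T r

/-! ### The all-electron Kohn–Sham energy -/

/-- The data of an all-electron Kohn–Sham system: nuclei with positive charges at distinct
positions, and an exchange-correlation energy per particle as a function of the density. -/
structure KSSystem where
  /-- the number of nuclei -/
  M : ℕ
  charge : Fin M → ℝ
  charge_pos : ∀ j, 0 < charge j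
  pos : Fin M → E3
  pos_injective : Function.Injective pos
  εxc : ℝ → ℝ
  εxc_continuousOn : ContinuousOn εxc (Ici 0)

namespace KSSystem

variable (K : KSSystem) {N : ℕ}

/-- The electronic density `ρ = ∑ₗ |uₗ|²`. -/
def density (u : Fin N → E3 → ℝ) (x : E3) : ℝ := ∑ l, (u l x) ^ 2

/-- The Coulomb attraction of the nuclei, `V_ext(x) = -∑ⱼ Zⱼ / |x - Rⱼ|`. -/
def Vext (x : E3) : ℝ := -∑ j, K.charge j / ‖x - K.pos j‖

/-- The Hartree potential `V_Har[ρ](x) = ∫ ρ(y) / |x - y| dy`. -/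
def VHar (ρ : E3 → ℝ) (x : E3) : ℝ := ∫ y, ρ y / ‖x - y‖

/-- The kinetic energy `½ ∑ₗ ∫ |∇uₗ|²`. (For continuous piecewise polynomials the weak
gradient is the classical gradient, which exists almost everywhere.) -/
def kineticEnergy (u : Fin N → E3 → ℝ) : ℝ := (1 / 2) * ∑ l, ∫ x, ‖∇ (u l) x‖ ^ 2

def externalEnergy (u : Fin N → E3 → ℝ) : ℝ := ∫ x, K.Vext x * density u x

def hartreeEnergy (u : Fin N → E3 → ℝ) : ℝ := (1 / 2) * ∫ x, VHar (density u) x * density u x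

def xcEnergy (u : Fin N → E3 → ℝ) : ℝ := ∫ x, K.εxc (density u x) * density u x

/-- The Coulomb repulsion of the nuclei, `∑_{j < k} Zⱼ Zₖ / |Rⱼ - Rₖ|`. -/
def nuclearEnergy : ℝ :=
  ∑ j, ∑ k ∈ Finset.Ioi j, K.charge j * K.charge k / ‖K.pos j - K.pos k‖

/-- The total energy
`E_KS = E_kinetic + E_ext + E_Har + E_xc + E_nuc`. -/
def totalEnergy (u : Fin N → E3 → ℝ) : ℝ :=
  kineticEnergy u + K.externalEnergy u + hartreeEnergy u + K.xcEnergy u + K.nuclearEnergy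

variable {T : TetMesh Ω} {r : ℕ}

/-- The total energy on `S^N`. -/
def energy (U : Orbitals T r N) : ℝ := K.totalEnergy fun l => (U l).toFun

end KSSystem

/-! ### Stiefel manifold, extended gradient and linearized scheme -/

variable {T : TetMesh Ω} {r N : ℕ}

/-- The inner product matrix `⟨Uᵀ V⟩ = ((uᵢ, vⱼ)_{L²})ᵢⱼ`. -/
def gram (U V : Orbitals T r N) : Matrix (Fin N) (Fin N) ℝ :=
  Matrix.of fun i j => inner ℝ (U i) (V j)

/-- The product `U P = (∑ⱼ pⱼ₁ uⱼ, …, ∑ⱼ p_{jN} uⱼ)`. -/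
def rmul (U : Orbitals T r N) (P : Matrix (Fin N) (Fin N) ℝ) : Orbitals T r N :=
  WithLp.toLp 2 fun i => ∑ j, P j i • U j

/-- The Stiefel manifold in `S^N`: the tuples with `⟨Uᵀ U⟩ = I_N`. -/
def stiefel (T : TetMesh Ω) (r N : ℕ) : Set (Orbitals T r N) := {U | gram U U = 1}

namespace KSSystem

variable (K : KSSystem)

/-- The (discrete) gradient `∇E(U) ∈ S^N`, that is, the element of `S^N` with
`(∇E(U), Φ) = E'(U)Φ` for all `Φ ∈ S^N`. -/
def gradE (U : Orbitals T r N) : Orbitals T r N := ∇ (K.energy (T := T) (r := r) (N := N)) U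

/-- The extended Grassmann gradient `∇_G E(U) = ∇E(U) ⟨Uᵀ U⟩ - U ⟨∇E(U), U⟩ᵀ`. -/
def gradG (U : Orbitals T r N) : Orbitals T r N :=
  rmul (K.gradE U) (gram U U) - rmul U (gram (K.gradE U) U).transpose

/-- The operator `𝒜_U = ∇E(U) Uᵀ - U ∇E(U)ᵀ`, i.e.
`𝒜_U V = ∇E(U) ⟨Uᵀ V⟩ - U ⟨∇E(U)ᵀ V⟩`. -/
def opA (U V : Orbitals T r N) : Orbitals T r N :=
  rmul (K.gradE U) (gram U V) - rmul U (gram (K.gradE U) V)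

/-- `U⁰, U¹, …` is a solution of the linearized scheme with time steps `Δtₙ`:
`(Uⁿ⁺¹ - Uⁿ) / Δtₙ = -𝒜_{Uⁿ} ((Uⁿ + Uⁿ⁺¹) / 2)` for all `n`. -/
def IsSchemeSolution (Δt : ℕ → ℝ) (U : ℕ → Orbitals T r N) : Prop :=
  ∀ n, (Δt n)⁻¹ • (U (n + 1) - U n) = -K.opA (U n) ((1 / 2 : ℝ) • (U n + U (n + 1)))

end KSSystem

end KohnSham

end

noncomputable section

namespace KohnSham

variable {Ω : Set E3} {T : TetMesh Ω} {r N : ℕ}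

/-! ### Orthogonal invariance of the energy -/

/-! The operator `V ↦ X⟨YᵀV⟩ - Y⟨XᵀV⟩` is skew even for the matrix-valued product `gram`. One time
step is therefore the Cayley transform of a skew operator: it exists and is unique for every
positive step, and it stays on the Stiefel manifold (`midpoint_scheme_iff`, `cayley_mem_stiefel`).

Orthogonal invariance of `E` makes `⟨Uᵀ∇E(U)⟩` symmetric. Hence on the manifold `𝒜_U U = ∇_G E(U)`,
and the energy has initial slope `-‖∇_G E(U)‖²` along the Cayley curve. Symmetry also lets `∇_G E`
replace `∇E` in `𝒜_U`, so `‖𝒜_U‖ ≤ 2√N ‖∇_G E(U)‖`. With the Lipschitz bound, the slope at time `s`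
then changes by at most a constant times `s‖∇_G E(U)‖²`, so short steps gain at least half the
initial slope (`energy_cayley_le`).

Isolation makes the orbit of `U*` coincide, in a tube around it, with both the critical points and
the minimizers (`exists_tube`). By compactness the energy exceeds `E(U*)` by a fixed amount on a
shell in the tube. Steps too short to jump the shell, along which the energy decreases, keep the
sequence inside. Divergence of the sum of the time steps then forces both limits
(`tendsto_of_descent`). -/

theorem sum_inner_orthogonal {V : Type*} [NormedAddCommGroup V] [InnerProductSpace ℝ V]
    {P : Matrix (Fin N) (Fin N) ℝ} (hP : P ∈ Matrix.orthogonalGroup (Fin N) ℝ) (x y : Fin N → V) :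
    ∑ i, inner ℝ (∑ j, P j i • x j) (∑ k, P k i • y k) = ∑ j, inner ℝ (x j) (y j) := by
  have h : P * P.transpose = 1 := (Matrix.mem_orthogonalGroup_iff _ _).1 hP
  calc ∑ i, inner ℝ (∑ j, P j i • x j) (∑ k, P k i • y k)
      = ∑ i, ∑ j, ∑ k, P j i * P k i * inner ℝ (x j) (y k) := by
        refine Finset.sum_congr rfl fun i _ => ?_
        rw [sum_inner]
        refine Finset.sum_congr rfl fun j _ => ?_
        rw [inner_sum]
        refine Finset.sum_congr rfl fun k _ => ?_
        rw [real_inner_smul_left, real_inner_smul_right, mul_assoc]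
    _ = ∑ j, ∑ k, (P * P.transpose) j k * inner ℝ (x j) (y k) := by
        rw [Finset.sum_comm]
        refine Finset.sum_congr rfl fun j _ => ?_
        rw [Finset.sum_comm]
        refine Finset.sum_congr rfl fun k _ => ?_
        rw [← Finset.sum_mul]
        rfl
    _ = ∑ j, inner ℝ (x j) (y j) := by
        simp [h, Matrix.one_apply]

/-! ### Almost-everywhere regularity of finite element functions -/

theorem contDiff_mvPolynomial_eval (p : MvPolynomial (Fin 3) ℝ) :
    ContDiff ℝ 1 fun x : E3 => MvPolynomial.eval (fun i => x i) p := by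
  have h := AnalyticOnNhd.eval_linearMap' (𝕜 := ℝ)
    (fun i => ((EuclideanSpace.proj i : E3 →L[ℝ] ℝ) : E3 →ₗ[ℝ] ℝ)) p
  exact (contDiffOn_univ.1 h.contDiffOn_of_completeSpace)

theorem tetrahedron_isCompact (v : Fin 4 → E3) : IsCompact (tetrahedron v) :=
  (Set.finite_range v).isCompact_convexHull ℝ

/-- Almost every point is either interior to a cell or exterior to `Ω`. -/
theorem TetMesh.ae_interior_or_exterior (T : TetMesh Ω) :
    ∀ᵐ x : E3, (∃ v ∈ T.cells, x ∈ interior (tetrahedron v)) ∨ x ∉ closure Ω := by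
  have h : ∀ᵐ x : E3, ∀ v ∈ T.cells, x ∉ frontier (tetrahedron v) := by
    refine (ae_ball_iff T.cells.countable_toSet).2 fun v _ => ?_
    exact measure_eq_zero_iff_ae_notMem.1
      ((convex_convexHull ℝ (range v)).addHaar_frontier volume)
  filter_upwards [h] with x hx
  by_cases hxΩ : x ∈ closure Ω
  · left
    rw [← T.covers] at hxΩ
    simp only [mem_iUnion] at hxΩ
    obtain ⟨v, hv, hxv⟩ := hxΩ
    refine ⟨v, hv, ?_⟩
    by_contra hc
    exact hx v hv ⟨subset_closure hxv, hc⟩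
  · exact Or.inr hxΩ

namespace FESpace

theorem eventuallyEq_polynomial (u : FESpace T r) {v : Fin 4 → E3} (hv : v ∈ T.cells) :
    ∃ p : MvPolynomial (Fin 3) ℝ, ∀ x ∈ interior (tetrahedron v),
      u.toFun =ᶠ[𝓝 x] fun y => MvPolynomial.eval (fun i => y i) p := by
  obtain ⟨p, -, hp⟩ := u.2.2.2 v hv
  refine ⟨p, fun x hx => ?_⟩
  filter_upwards [mem_interior_iff_mem_nhds.1 hx] with y hy using hp y hy

theorem eventuallyEq_zero (u : FESpace T r) {x : E3} (hx : x ∉ closure Ω) :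
    u.toFun =ᶠ[𝓝 x] fun _ => 0 := by
  filter_upwards [isClosed_closure.isOpen_compl.mem_nhds hx] with y hy
    using u.toFun_eq_zero fun h => hy (subset_closure h)

theorem ae_differentiableAt (u : FESpace T r) : ∀ᵐ x, DifferentiableAt ℝ u.toFun x := by
  filter_upwards [T.ae_interior_or_exterior] with x hx
  rcases hx with ⟨v, hv, hx⟩ | hx
  · obtain ⟨p, hp⟩ := u.eventuallyEq_polynomial hv
    exact (hp x hx).differentiableAt_iff.2
      ((contDiff_mvPolynomial_eval p).differentiable one_ne_zero x)
  · exact (u.eventuallyEq_zero hx).differentiableAt_iff.2 (differentiableAt_const 0)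

theorem norm_gradient_eq (f : E3 → ℝ) (x : E3) : ‖∇ f x‖ = ‖fderiv ℝ f x‖ := by
  rw [← toDual_gradient, LinearIsometryEquiv.norm_map]

/-- On the interior of a cell the gradient is that of a polynomial, hence bounded on the compact
cell; the cell boundaries are null sets. -/
theorem exists_ae_norm_gradient_le (u : FESpace T r) :
    ∃ C : ℝ, ∀ᵐ x, ‖∇ u.toFun x‖ ≤ (closure Ω).indicator (fun _ => C) x := by
  have h : ∀ v ∈ T.cells, ∃ C : ℝ, ∀ x ∈ interior (tetrahedron v), ‖∇ u.toFun x‖ ≤ C := by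
    intro v hv
    obtain ⟨p, hp⟩ := u.eventuallyEq_polynomial hv
    obtain ⟨C, hC⟩ := (tetrahedron_isCompact v).exists_bound_of_continuousOn
      ((contDiff_mvPolynomial_eval p).continuous_fderiv one_ne_zero).continuousOn
    refine ⟨C, fun x hx => ?_⟩
    rw [norm_gradient_eq, (hp x hx).fderiv_eq]
    exact hC x (interior_subset hx)
  choose! C hC using h
  refine ⟨∑ v ∈ T.cells, |C v|, ?_⟩
  filter_upwards [T.ae_interior_or_exterior] with x hx
  rcases hx with ⟨v, hv, hx⟩ | hx
  · have hxΩ : x ∈ closure Ω := by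
      rw [← T.covers]
      exact mem_biUnion hv (interior_subset hx)
    rw [indicator_of_mem hxΩ]
    exact ((hC v hv x hx).trans (le_abs_self _)).trans
      (Finset.single_le_sum (f := fun v => |C v|) (fun _ _ => abs_nonneg _) hv)
  · rw [indicator_of_notMem hx, norm_gradient_eq, (u.eventuallyEq_zero hx).fderiv_eq]
    simp

theorem integrable_norm_gradient_sq (u : FESpace T r) :
    Integrable fun x => ‖∇ u.toFun x‖ ^ 2 := by
  obtain ⟨C, hC⟩ := u.exists_ae_norm_gradient_le
  have hK : IsCompact (closure Ω) := isCompact_closure T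
  have hI : Integrable ((closure Ω).indicator fun _ : E3 => C ^ 2) :=
    (integrable_indicator_iff hK.measurableSet).2
      (integrableOn_const (μ := volume) hK.measure_lt_top.ne)
  refine hI.mono' ?_ ?_
  · simp only [norm_gradient_eq]
    exact ((measurable_fderiv ℝ u.toFun).norm.pow_const 2).aestronglyMeasurable
  · filter_upwards [hC] with x hx
    rw [Real.norm_of_nonneg (by positivity)]
    by_cases h : x ∈ closure Ω
    · simp only [h, indicator_of_mem] at hx ⊢
      exact pow_le_pow_left₀ (norm_nonneg _) hx 2
    · simp only [h, not_false_eq_true, indicator_of_notMem] at hx ⊢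
      rw [le_antisymm hx (norm_nonneg _)]
      simp

/-- Evaluation at a point as a linear map. -/
def evalₗ (x : E3) : FESpace T r →ₗ[ℝ] ℝ where
  toFun u := u.toFun x
  map_add' _ _ := rfl
  map_smul' _ _ := rfl

theorem toFun_sum_smul (c : Fin N → ℝ) (u : Fin N → FESpace T r) :
    (∑ j, c j • u j).toFun = fun x => ∑ j, c j * (u j).toFun x := by
  funext x
  have := map_sum (evalₗ (T := T) (r := r) x) (fun j => c j • u j) Finset.univ
  simp only [map_smul, smul_eq_mul] at this
  exact this

end FESpace

/-! ### Invariance of density, kinetic energy and total energy -/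

theorem rmul_apply (U : Orbitals T r N) (P : Matrix (Fin N) (Fin N) ℝ) (i : Fin N) :
    rmul U P i = ∑ j, P j i • U j := rfl

theorem density_rmul (U : Orbitals T r N) {P : Matrix (Fin N) (Fin N) ℝ}
    (hP : P ∈ Matrix.orthogonalGroup (Fin N) ℝ) :
    KSSystem.density (fun l => (rmul U P l).toFun) = KSSystem.density fun l => (U l).toFun := by
  funext x
  have := sum_inner_orthogonal hP (fun j => (U j).toFun x) fun j => (U j).toFun x
  simpa only [KSSystem.density, rmul_apply, FESpace.toFun_sum_smul, smul_eq_mul, sq,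
    real_inner_eq_re_inner, RCLike.inner_apply, conj_trivial, RCLike.re_to_real] using this

/-- Integrability of each squared gradient allows the sum to move under the integral; the integrands
then agree wherever all orbitals are differentiable, by `sum_inner_orthogonal` applied to the
gradients. -/
theorem kineticEnergy_rmul (U : Orbitals T r N) {P : Matrix (Fin N) (Fin N) ℝ}
    (hP : P ∈ Matrix.orthogonalGroup (Fin N) ℝ) :
    KSSystem.kineticEnergy (fun l => (rmul U P l).toFun)
      = KSSystem.kineticEnergy fun l => (U l).toFun := by
  unfold KSSystem.kineticEnergy
  congr 1
  rw [← integral_finsetSum _ fun l _ => (rmul U P l).integrable_norm_gradient_sq,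
    ← integral_finsetSum _ fun l _ => (U l).integrable_norm_gradient_sq]
  refine integral_congr_ae ?_
  have hd : ∀ᵐ x, ∀ l, DifferentiableAt ℝ (U l).toFun x :=
    ae_all_iff.2 fun l => (U l).ae_differentiableAt
  filter_upwards [hd] with x hx
  have hg : ∀ l, ∇ (rmul U P l).toFun x = ∑ j, P j l • ∇ (U j).toFun x := by
    intro l
    refine HasGradientAt.gradient (hasGradientAt_iff_hasFDerivAt.2 ?_)
    simp only [map_sum, map_smul, toDual_gradient]
    rw [rmul_apply, FESpace.toFun_sum_smul]
    exact HasFDerivAt.fun_sum fun j _ => (hx j).hasFDerivAt.const_mul (P j l)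
  have := sum_inner_orthogonal hP (fun j => ∇ (U j).toFun x) fun j => ∇ (U j).toFun x
  simpa only [hg, real_inner_self_eq_norm_sq] using this

/-- The Kohn–Sham energy is invariant under orthogonal transformations of the orbitals. -/
theorem KSSystem.energy_rmul (K : KSSystem) (U : Orbitals T r N) {P : Matrix (Fin N) (Fin N) ℝ}
    (hP : P ∈ Matrix.orthogonalGroup (Fin N) ℝ) : K.energy (rmul U P) = K.energy U := by
  simp only [KSSystem.energy, KSSystem.totalEnergy, KSSystem.externalEnergy,
    KSSystem.hartreeEnergy, KSSystem.xcEnergy, kineticEnergy_rmul U hP, density_rmul U hP]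

end KohnSham

namespace KohnSham

variable {Ω : Set E3} {T : TetMesh Ω} {r N : ℕ}

/-! ### Algebra of orbitals -/

theorem gram_apply (U V : Orbitals T r N) (i j : Fin N) : gram U V i j = inner ℝ (U i) (V j) := rfl

/-- `U ↦ (P ↦ U P)` as a bilinear map. -/
def rmulₗ : Orbitals T r N →ₗ[ℝ] Matrix (Fin N) (Fin N) ℝ →ₗ[ℝ] Orbitals T r N :=
  LinearMap.mk₂ ℝ rmul
    (fun U V P => by ext1 i; simp [rmul_apply, smul_add, Finset.sum_add_distrib])
    (fun c U P => by ext1 i; simp [rmul_apply, Finset.smul_sum, smul_comm c])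
    (fun U P Q => by ext1 i; simp [rmul_apply, add_smul, Finset.sum_add_distrib])
    (fun c U P => by ext1 i; simp [rmul_apply, Finset.smul_sum, smul_smul])

/-- `(U, V) ↦ ⟨Uᵀ V⟩` as a bilinear map. -/
def gramₗ : Orbitals T r N →ₗ[ℝ] Orbitals T r N →ₗ[ℝ] Matrix (Fin N) (Fin N) ℝ :=
  LinearMap.mk₂ ℝ gram
    (fun U V W => by ext i j; simp [gram_apply, inner_add_left])
    (fun c U W => by ext i j; simp [gram_apply, real_inner_smul_left])
    (fun U V W => by ext i j; simp [gram_apply, inner_add_right])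
    (fun c U W => by ext i j; simp [gram_apply, real_inner_smul_right])

theorem rmulₗ_apply (U : Orbitals T r N) (P : Matrix (Fin N) (Fin N) ℝ) :
    rmulₗ U P = rmul U P := rfl

theorem gramₗ_apply (U V : Orbitals T r N) : gramₗ U V = gram U V := rfl

theorem rmul_sub_left (U V : Orbitals T r N) (P : Matrix (Fin N) (Fin N) ℝ) :
    rmul (U - V) P = rmul U P - rmul V P := by
  simp only [← rmulₗ_apply, map_sub, LinearMap.sub_apply]

theorem rmul_one (U : Orbitals T r N) : rmul U 1 = U := by
  ext1 i
  simp [rmul_apply, Matrix.one_apply]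

theorem rmul_zero_left (P : Matrix (Fin N) (Fin N) ℝ) : rmul (0 : Orbitals T r N) P = 0 := by
  simp only [← rmulₗ_apply, map_zero, LinearMap.zero_apply]

theorem rmul_rmul (U : Orbitals T r N) (P Q : Matrix (Fin N) (Fin N) ℝ) :
    rmul (rmul U P) Q = rmul U (P * Q) := by
  ext1 i
  simp only [rmul_apply, Matrix.mul_apply, Finset.smul_sum, Finset.sum_smul, smul_smul]
  rw [Finset.sum_comm]
  simp only [mul_comm]

theorem gram_rmul_right (U V : Orbitals T r N) (P : Matrix (Fin N) (Fin N) ℝ) :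
    gram U (rmul V P) = gram U V * P := by
  ext i j
  simp only [gram_apply, rmul_apply, inner_sum, real_inner_smul_right, Matrix.mul_apply, mul_comm]

theorem gram_transpose (U V : Orbitals T r N) : (gram U V).transpose = gram V U := by
  ext i j
  simp only [gram_apply, Matrix.transpose_apply, real_inner_comm]

theorem gram_rmul_left (U V : Orbitals T r N) (P : Matrix (Fin N) (Fin N) ℝ) :
    gram (rmul U P) V = P.transpose * gram U V := by
  rw [← gram_transpose, gram_rmul_right, Matrix.transpose_mul, gram_transpose]

theorem gram_sub_left (U V W : Orbitals T r N) : gram (U - V) W = gram U W - gram V W := by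
  simp only [← gramₗ_apply, map_sub, LinearMap.sub_apply]

theorem inner_rmul_orthogonal (U V : Orbitals T r N) {P : Matrix (Fin N) (Fin N) ℝ}
    (hP : P ∈ Matrix.orthogonalGroup (Fin N) ℝ) :
    inner ℝ (rmul U P) (rmul V P) = inner ℝ U V := by
  simp only [PiLp.inner_apply, rmul_apply]
  exact sum_inner_orthogonal hP _ _

theorem norm_rmul_orthogonal (U : Orbitals T r N) {P : Matrix (Fin N) (Fin N) ℝ}
    (hP : P ∈ Matrix.orthogonalGroup (Fin N) ℝ) : ‖rmul U P‖ = ‖U‖ := by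
  rw [@norm_eq_sqrt_real_inner _ _ _ (rmul U P), inner_rmul_orthogonal U U hP,
    ← norm_eq_sqrt_real_inner]

theorem rmul_mem_stiefel {U : Orbitals T r N} (hU : U ∈ stiefel T r N)
    {P : Matrix (Fin N) (Fin N) ℝ} (hP : P ∈ Matrix.orthogonalGroup (Fin N) ℝ) :
    rmul U P ∈ stiefel T r N := by
  have h : gram U U = 1 := hU
  change gram (rmul U P) (rmul U P) = 1
  rw [gram_rmul_left, gram_rmul_right, h, one_mul, (Matrix.mem_orthogonalGroup_iff' _ _).1 hP]

/-- Cauchy–Schwarz is used twice: in `L²` for each Gram entry, and over the index `j`. -/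
theorem norm_rmul_gram_le (X Y V : Orbitals T r N) :
    ‖rmul X (gram Y V)‖ ≤ ‖X‖ * ‖Y‖ * ‖V‖ := by
  have hCS : ∑ j, ‖Y j‖ * ‖X j‖ ≤ ‖X‖ * ‖Y‖ := by
    rw [mul_comm ‖X‖, PiLp.norm_eq_of_L2, PiLp.norm_eq_of_L2]
    exact Real.sum_mul_le_sqrt_mul_sqrt _ _ _
  have hi : ∀ i, ‖rmul X (gram Y V) i‖ ≤ ‖X‖ * ‖Y‖ * ‖V i‖ := fun i => by
    calc ‖rmul X (gram Y V) i‖ ≤ ∑ j, ‖gram Y V j i • X j‖ := norm_sum_le Finset.univ fun j => gram Y V j i • X j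
      _ ≤ ∑ j, ‖Y j‖ * ‖X j‖ * ‖V i‖ := Finset.sum_le_sum fun j _ => by
          rw [norm_smul, mul_right_comm]
          exact mul_le_mul_of_nonneg_right (norm_inner_le_norm (𝕜 := ℝ) (Y j) (V i)) (norm_nonneg _)
      _ ≤ _ := by
          rw [← Finset.sum_mul]
          exact mul_le_mul_of_nonneg_right hCS (norm_nonneg _)
  rw [← Real.sqrt_sq (norm_nonneg V), PiLp.norm_eq_of_L2, PiLp.norm_sq_eq_of_L2,
    ← Real.sqrt_sq (show (0 : ℝ) ≤ ‖X‖ * ‖Y‖ by positivity), ← Real.sqrt_mul (sq_nonneg _)]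
  refine Real.sqrt_le_sqrt ?_
  rw [Finset.mul_sum]
  refine Finset.sum_le_sum fun i _ => ?_
  rw [← mul_pow]
  exact pow_le_pow_left₀ (norm_nonneg _) (hi i) 2

theorem norm_sq_of_mem_stiefel {U : Orbitals T r N} (hU : U ∈ stiefel T r N) : ‖U‖ ^ 2 = N := by
  have h : gram U U = 1 := hU
  rw [PiLp.norm_sq_eq_of_L2]
  have : ∀ i, ‖U i‖ ^ 2 = 1 := fun i => by
    rw [← real_inner_self_eq_norm_sq, ← gram_apply, h, Matrix.one_apply_eq]
  simp [this]

theorem continuous_gram : Continuous fun p : Orbitals T r N × Orbitals T r N => gram p.1 p.2 := by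
  refine continuous_matrix fun i j => ?_
  simp only [gram_apply]
  fun_prop

theorem continuous_rmul :
    Continuous fun p : Orbitals T r N × Matrix (Fin N) (Fin N) ℝ => rmul p.1 p.2 := by
  refine (PiLp.continuous_toLp 2 _).comp (continuous_pi fun i => ?_)
  refine continuous_finsetSum _ fun j _ => ?_
  exact ((continuous_apply_apply j i).comp continuous_snd).smul
    ((PiLp.continuous_apply 2 _ j).comp continuous_fst)

theorem isCompact_stiefel : IsCompact (stiefel T r N) := by
  refine Metric.isCompact_of_isClosed_isBounded ?_ ?_
  · exact isClosed_singleton.preimage (continuous_gram.comp (continuous_id.prodMk continuous_id))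
  · refine isBounded_iff_forall_norm_le.2 ⟨√N, fun U hU => ?_⟩
    rw [← norm_sq_of_mem_stiefel hU, Real.sqrt_sq (norm_nonneg _)]

/-! ### The operator `V ↦ X ⟨Yᵀ V⟩ - Y ⟨Xᵀ V⟩` -/

/-- `V ↦ X ⟨Yᵀ V⟩ - Y ⟨Xᵀ V⟩`. -/
def skewOp (X Y : Orbitals T r N) : Orbitals T r N →L[ℝ] Orbitals T r N :=
  LinearMap.toContinuousLinearMap (rmulₗ X ∘ₗ gramₗ Y - rmulₗ Y ∘ₗ gramₗ X)

theorem skewOp_apply (X Y V : Orbitals T r N) :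
    skewOp X Y V = rmul X (gram Y V) - rmul Y (gram X V) := rfl

/-- Skewness for the whole Gram matrix, not only for its trace, is what preserves orthonormality of
the orbitals. -/
theorem gram_skewOp (X Y V W : Orbitals T r N) :
    gram (skewOp X Y V) W = -gram V (skewOp X Y W) := by
  rw [← gram_transpose (skewOp X Y W)]
  simp only [skewOp_apply, gram_sub_left, gram_rmul_left, Matrix.transpose_sub,
    Matrix.transpose_mul, gram_transpose]
  abel

theorem inner_eq_trace_gram (U V : Orbitals T r N) : inner ℝ U V = (gram U V).trace := rfl

theorem inner_skewOp (X Y V W : Orbitals T r N) :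
    inner ℝ (skewOp X Y V) W = -inner ℝ V (skewOp X Y W) := by
  simp only [inner_eq_trace_gram, gram_skewOp, Matrix.trace_neg]

theorem norm_skewOp_le (X Y : Orbitals T r N) : ‖skewOp X Y‖ ≤ 2 * ‖X‖ * ‖Y‖ := by
  refine ContinuousLinearMap.opNorm_le_bound _ (by positivity) fun V => ?_
  rw [skewOp_apply]
  have h1 := norm_rmul_gram_le X Y V
  have h2 := norm_rmul_gram_le Y X V
  have h3 := norm_sub_le (rmul X (gram Y V)) (rmul Y (gram X V))
  linarith [mul_comm ‖X‖ ‖Y‖, congrArg (· * ‖V‖) (mul_comm ‖X‖ ‖Y‖)]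

/-! ### Gradients -/

namespace KSSystem

variable (K : KSSystem)

theorem opA_eq_skewOp (U V : Orbitals T r N) : K.opA U V = skewOp (K.gradE U) U V := rfl

open scoped Matrix.Norms.Operator in
-- For skew `W` the matrices `exp(tW)` are orthogonal, so the energy is constant along `t ↦ U
-- exp(tW)`; its derivative at `t = 0` is the inner product.
theorem inner_gradE_rmul_skew {U : Orbitals T r N} (hd : DifferentiableAt ℝ K.energy U)
    {W : Matrix (Fin N) (Fin N) ℝ} (hW : W.transpose = -W) :
    inner ℝ (K.gradE U) (rmul U W) = 0 := by
  have h1 := hasDerivAt_exp_smul_const (𝕂 := ℝ) W (0 : ℝ)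
  rw [zero_smul, NormedSpace.exp_zero, one_mul] at h1
  have h2 : HasDerivAt (fun t : ℝ => rmul U (NormedSpace.exp (t • W))) (rmul U W) 0 :=
    (LinearMap.toContinuousLinearMap (rmulₗ U)).hasFDerivAt.comp_hasDerivAt (0 : ℝ) h1
  have h0 : rmul U (NormedSpace.exp ((0 : ℝ) • W)) = U := by simp [rmul_one]
  have h3 : HasDerivAt (fun t : ℝ => K.energy (rmul U (NormedSpace.exp (t • W))))
      (inner ℝ (K.gradE U) (rmul U W)) 0 := by
    have hg : HasFDerivAt K.energy (InnerProductSpace.toDual ℝ _ (K.gradE U))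
        (rmul U (NormedSpace.exp ((0 : ℝ) • W))) := by
      rw [h0]
      exact hd.hasGradientAt.hasFDerivAt
    exact hg.comp_hasDerivAt (0 : ℝ) h2
  have h4 : ∀ t : ℝ, K.energy (rmul U (NormedSpace.exp (t • W))) = K.energy U := fun t => by
    refine K.energy_rmul U ((Matrix.mem_orthogonalGroup_iff _ _).2 ?_)
    rw [← Matrix.exp_transpose, Matrix.transpose_smul, hW, smul_neg, Matrix.exp_neg]
    exact Matrix.mul_nonsing_inv _ ((Matrix.isUnit_iff_isUnit_det _).1 (Matrix.isUnit_exp _))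
  simp only [h4] at h3
  exact h3.unique (hasDerivAt_const _ _)

theorem gram_gradE_comm {U : Orbitals T r N} (hd : DifferentiableAt ℝ K.energy U) :
    gram U (K.gradE U) = gram (K.gradE U) U := by
  have h := K.inner_gradE_rmul_skew hd
    (W := gram U (K.gradE U) - gram (K.gradE U) U) (by
      rw [Matrix.transpose_sub, gram_transpose, gram_transpose, neg_sub])
  rw [inner_eq_trace_gram, gram_rmul_right] at h
  set S := gram (K.gradE U) U with hS
  have hS' : gram U (K.gradE U) = S.transpose := by rw [hS, gram_transpose]
  rw [hS'] at h ⊢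
  -- Testing with the skew matrix `W = Sᵀ - S` gave `tr(SW) = 0`. Since `tr(WᵀW) = 2 tr(SW)`, it
  -- follows that `W = 0`.
  have h2 : ((S.transpose - S).transpose * (S.transpose - S)).trace = 0 := by
    have e : ((S.transpose - S).transpose * (S.transpose - S)).trace
        = (S * (S.transpose - S)).trace + (S * (S.transpose - S)).trace := by
      rw [Matrix.transpose_sub, Matrix.transpose_transpose, sub_mul, Matrix.trace_sub,
        sub_eq_add_neg, ← Matrix.trace_neg, ← mul_neg, neg_sub]
      congr 1
      rw [← Matrix.trace_transpose, Matrix.transpose_mul, Matrix.transpose_sub,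
        Matrix.transpose_transpose, Matrix.trace_mul_comm]
    rw [e, h, add_zero]
  have h3 := Matrix.trace_conjTranspose_mul_self_eq_zero_iff (A := S.transpose - S)
  rw [Matrix.conjTranspose_eq_transpose_of_trivial] at h3
  exact sub_eq_zero.1 (h3.1 h2)

theorem gradG_eq {U : Orbitals T r N} (hU : U ∈ stiefel T r N) :
    K.gradG U = K.gradE U - rmul U (gram U (K.gradE U)) := by
  have h : gram U U = 1 := hU
  rw [gradG, h, rmul_one, gram_transpose]

variable {K}

theorem opA_self {U : Orbitals T r N} (hU : U ∈ stiefel T r N)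
    (hd : DifferentiableAt ℝ K.energy U) : K.opA U U = K.gradG U := by
  have h : gram U U = 1 := hU
  rw [K.gradG_eq hU, K.gram_gradE_comm hd, opA, h, rmul_one]

theorem gram_gradG {U : Orbitals T r N} (hU : U ∈ stiefel T r N) : gram U (K.gradG U) = 0 := by
  have h : gram U U = 1 := hU
  rw [K.gradG_eq hU, ← gram_transpose, gram_sub_left, gram_rmul_left, h, mul_one,
    ← gram_transpose U, sub_self, Matrix.transpose_zero]

/-- The two gradients differ by some `U M`, and `∇_G E(U)` is orthogonal to all of these by
`gram_gradG`. -/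
theorem inner_gradE_gradG {U : Orbitals T r N} (hU : U ∈ stiefel T r N) :
    inner ℝ (K.gradE U) (K.gradG U) = ‖K.gradG U‖ ^ 2 := by
  have h1 : K.gradE U = K.gradG U + rmul U (gram U (K.gradE U)) := by
    rw [K.gradG_eq hU, sub_add_cancel]
  have h2 : inner ℝ (rmul U (gram U (K.gradE U))) (K.gradG U) = 0 := by
    rw [inner_eq_trace_gram, gram_rmul_left, gram_gradG hU, mul_zero, Matrix.trace_zero]
  nth_rewrite 1 [h1]
  rw [inner_add_left, h2, add_zero, real_inner_self_eq_norm_sq]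

/-- Writing `∇E = ∇_G E + U S` with `S` symmetric, the two contributions of `U S` cancel. The
operator norm is thereby controlled by `‖∇_G E‖`, which makes the error terms of a step quadratic in
it. -/
theorem skewOp_gradE {U : Orbitals T r N} (hU : U ∈ stiefel T r N)
    (hd : DifferentiableAt ℝ K.energy U) : skewOp (K.gradE U) U = skewOp (K.gradG U) U := by
  ext1 V
  have h1 : (gram U (K.gradE U)).transpose = gram U (K.gradE U) := by
    rw [gram_transpose, K.gram_gradE_comm hd]
  rw [skewOp_apply, skewOp_apply, K.gradG_eq hU, rmul_sub_left, gram_sub_left, rmul_rmul,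
    gram_rmul_left, h1, ← rmulₗ_apply U (gram (K.gradE U) V - _), map_sub]
  simp only [rmulₗ_apply]
  abel

theorem norm_skewOp_gradE_le {U : Orbitals T r N} (hU : U ∈ stiefel T r N)
    (hd : DifferentiableAt ℝ K.energy U) :
    ‖skewOp (K.gradE U) U‖ ≤ 2 * √N * ‖K.gradG U‖ := by
  have h := norm_skewOp_le (K.gradG U) U
  rw [skewOp_gradE hU hd]
  have h2 : ‖U‖ = √N := by rw [← norm_sq_of_mem_stiefel hU, Real.sqrt_sq (norm_nonneg _)]
  rw [h2] at h
  linarith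

/-- Differentiate `E(VP) = E(V)` in `V`; since `V ↦ VP` is an isometry with inverse `V ↦ VPᵀ`, the
gradient is carried along. -/
theorem gradE_rmul {U : Orbitals T r N} {P : Matrix (Fin N) (Fin N) ℝ}
    (hP : P ∈ Matrix.orthogonalGroup (Fin N) ℝ)
    (hd : DifferentiableAt ℝ K.energy (rmul U P)) : K.gradE (rmul U P) = rmul (K.gradE U) P := by
  set R : Orbitals T r N →L[ℝ] Orbitals T r N :=
    LinearMap.toContinuousLinearMap (rmulₗ.flip P) with hR
  have h1 : HasFDerivAt (fun V => K.energy (rmul V P))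
      ((InnerProductSpace.toDual ℝ _ (K.gradE (rmul U P))).comp R) U :=
    HasFDerivAt.comp (g := K.energy) U hd.hasGradientAt.hasFDerivAt R.hasFDerivAt
  simp only [K.energy_rmul _ hP] at h1
  have hPP : P.transpose * P = 1 := (Matrix.mem_orthogonalGroup_iff' _ _).1 hP
  have h2 : ∀ V, inner ℝ (K.gradE U) V = inner ℝ (K.gradE (rmul U P)) (rmul V P) := fun V => by
    have h := congrArg (fun L : Orbitals T r N →L[ℝ] ℝ => L V) h1.fderiv
    simp only [← toDual_gradient] at h
    exact h
  refine ext_inner_right ℝ fun V => ?_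
  have h3 : rmul (rmul V P.transpose) P = V := by rw [rmul_rmul, hPP, rmul_one]
  rw [← h3, ← h2, inner_rmul_orthogonal _ _ hP]

theorem gradG_rmul {U : Orbitals T r N} (hU : U ∈ stiefel T r N) {P : Matrix (Fin N) (Fin N) ℝ}
    (hP : P ∈ Matrix.orthogonalGroup (Fin N) ℝ)
    (hd : DifferentiableAt ℝ K.energy (rmul U P)) : K.gradG (rmul U P) = rmul (K.gradG U) P := by
  have hPP : P * P.transpose = 1 := (Matrix.mem_orthogonalGroup_iff _ _).1 hP
  rw [K.gradG_eq (rmul_mem_stiefel hU hP), K.gradG_eq hU, gradE_rmul hP hd, gram_rmul_right,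
    gram_rmul_left, rmul_rmul, rmul_sub_left, rmul_rmul, ← mul_assoc, ← mul_assoc, hPP, one_mul]

theorem continuousOn_gradG (hc : ContinuousOn K.gradE (stiefel T r N)) :
    ContinuousOn K.gradG (stiefel T r N) := by
  have h : ContinuousOn (fun U => K.gradE U - rmul U (gram U (K.gradE U))) (stiefel T r N) :=
    hc.sub (continuous_rmul.comp_continuousOn (continuousOn_id.prodMk
      (continuous_gram.comp_continuousOn (continuousOn_id.prodMk hc))))
  exact h.congr fun U hU => K.gradG_eq hU

end KSSystem

end KohnSham

namespace KohnSham

/-! ### Cayley curves of skew operators -/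

section Cayley

variable {H : Type*} [NormedAddCommGroup H] [InnerProductSpace ℝ H] {A : H →L[ℝ] H}

/-- Pythagoras, since `A v` is orthogonal to `v`. This one estimate yields invertibility, uniqueness
and the step-size-free bounds below. -/
theorem norm_le_norm_add_smul_skew (hA : ∀ v, inner ℝ v (A v) = 0) (c : ℝ) (v : H) :
    ‖v‖ ≤ ‖v + c • A v‖ := by
  refine le_of_sq_le_sq ?_ (norm_nonneg _)
  rw [norm_add_sq_real, real_inner_smul_right, hA]
  nlinarith [sq_nonneg ‖c • A v‖]

variable [FiniteDimensional ℝ H]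

theorem isUnit_one_add_smul_skew (hA : ∀ v, inner ℝ v (A v) = 0) (c : ℝ) :
    IsUnit (1 + c • A) := by
  have : CompleteSpace H := FiniteDimensional.complete ℝ H
  have hinj : Function.Injective (1 + c • A : H →L[ℝ] H) := by
    refine (injective_iff_map_eq_zero _).2 fun v hv => ?_
    have h := norm_le_norm_add_smul_skew hA c v
    have hv' : v + c • A v = 0 := hv
    rw [hv', norm_zero] at h
    exact norm_le_zero_iff.1 h
  exact ContinuousLinearMap.isUnit_iff_bijective.2
    ⟨hinj, (LinearMap.injective_iff_surjective
      (f := ((1 + c • A : H →L[ℝ] H) : H →ₗ[ℝ] H))).1 hinj⟩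

/-- The midpoint `(1 + s/2 A)⁻¹ u` of the Cayley step of length `s` from `u`. -/
def cayleyMid (A : H →L[ℝ] H) (u : H) (s : ℝ) : H := Ring.inverse (1 + (s / 2) • A) u

/-- The Cayley step `(1 + s/2 A)⁻¹ (1 - s/2 A) u` of length `s` from `u`. -/
def cayley (A : H →L[ℝ] H) (u : H) (s : ℝ) : H := (2 : ℝ) • cayleyMid A u s - u

theorem cayleyMid_add (hA : ∀ v, inner ℝ v (A v) = 0) (u : H) (s : ℝ) :
    cayleyMid A u s + (s / 2) • A (cayleyMid A u s) = u :=
  congrArg (fun B : H →L[ℝ] H => B u)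
    (Ring.mul_inverse_cancel _ (isUnit_one_add_smul_skew hA (s / 2)))

theorem eq_cayleyMid_of_add (hA : ∀ v, inner ℝ v (A v) = 0) {u w : H} {s : ℝ}
    (h : w + (s / 2) • A w = u) : w = cayleyMid A u s := by
  have h1 := norm_le_norm_add_smul_skew hA (s / 2) (w - cayleyMid A u s)
  have h2 : w - cayleyMid A u s + (s / 2) • A (w - cayleyMid A u s) = 0 := by
    rw [map_sub, smul_sub, sub_add_sub_comm, h, cayleyMid_add hA, sub_self]
  rw [h2, norm_zero] at h1
  exact sub_eq_zero.1 (norm_le_zero_iff.1 h1)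

theorem cayley_eq_sub (hA : ∀ v, inner ℝ v (A v) = 0) (u : H) (s : ℝ) :
    cayley A u s = cayleyMid A u s - (s / 2) • A (cayleyMid A u s) := by
  have h := cayleyMid_add hA u s
  rw [cayley]
  generalize cayleyMid A u s = w at h ⊢
  rw [← h]
  module

theorem cayley_sub_self (hA : ∀ v, inner ℝ v (A v) = 0) (u : H) (s : ℝ) :
    cayley A u s - u = -s • A (cayleyMid A u s) := by
  nth_rewrite 2 [← cayleyMid_add hA u s]
  rw [cayley_eq_sub hA]
  module

theorem cayley_zero (hA : ∀ v, inner ℝ v (A v) = 0) (u : H) : cayley A u 0 = u :=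
  sub_eq_zero.1 ((cayley_sub_self hA u 0).trans (by simp))

/-- The midpoint `w` of a step satisfies `w + (s/2) A w = u`, which determines it, and the new point
is `2w - u`. -/
theorem midpoint_scheme_iff (hA : ∀ v, inner ℝ v (A v) = 0) {u v : H} {s : ℝ} (hs : s ≠ 0) :
    s⁻¹ • (v - u) = -A ((1 / 2 : ℝ) • (u + v)) ↔ v = cayley A u s := by
  constructor
  · intro h
    have h1 : v - u = -s • A ((1 / 2 : ℝ) • (u + v)) := by
      rw [neg_smul, ← smul_neg, ← h, smul_smul, mul_inv_cancel₀ hs, one_smul]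
    have h2 : (1 / 2 : ℝ) • (u + v) = cayleyMid A u s := by
      refine eq_cayleyMid_of_add hA ?_
      have h3 : (s / 2) • A ((1 / 2 : ℝ) • (u + v)) = (-(1 / 2) : ℝ) • (v - u) := by
        rw [h1]
        module
      rw [h3]
      module
    rw [cayley, ← h2]
    module
  · rintro rfl
    have h2 : (1 / 2 : ℝ) • (u + cayley A u s) = cayleyMid A u s := by
      rw [cayley]
      module
    rw [h2, cayley_sub_self hA, smul_smul, mul_neg, inv_mul_cancel₀ hs, neg_smul, one_smul]

theorem norm_apply_cayleyMid_le (hA : ∀ v, inner ℝ v (A v) = 0) (u : H) (s : ℝ) :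
    ‖A (cayleyMid A u s)‖ ≤ ‖A u‖ := by
  -- The bound is applied to `A w` with `w` the midpoint; as `A` commutes with `1 + (s/2) A`, the
  -- right side becomes `‖A u‖`.
  refine (norm_le_norm_add_smul_skew hA (s / 2) _).trans_eq ?_
  rw [← map_smul, ← map_add, cayleyMid_add hA]

theorem norm_cayley_sub_le (hA : ∀ v, inner ℝ v (A v) = 0) (u : H) {s : ℝ} (hs : 0 ≤ s) :
    ‖cayley A u s - u‖ ≤ s * ‖A u‖ := by
  rw [cayley_sub_self hA, norm_smul, norm_neg, Real.norm_of_nonneg hs]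
  exact mul_le_mul_of_nonneg_left (norm_apply_cayleyMid_le hA u s) hs

/-- The velocity of the Cayley curve. -/
def cayleyDeriv (A : H →L[ℝ] H) (u : H) (s : ℝ) : H := -cayleyMid A (A (cayleyMid A u s)) s

theorem hasDerivAt_cayley (hA : ∀ v, inner ℝ v (A v) = 0) (u : H) (s : ℝ) :
    HasDerivAt (cayley A u) (cayleyDeriv A u s) s := by
  have : CompleteSpace H := FiniteDimensional.complete ℝ H
  obtain ⟨B, hB⟩ := isUnit_one_add_smul_skew hA (s / 2)
  have h1 : HasDerivAt (fun t : ℝ => 1 + (t / 2) • A) ((1 / 2 : ℝ) • A) s :=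
    (((hasDerivAt_id s).div_const 2).smul_const A).const_add 1
  have h2 : HasFDerivAt Ring.inverse
      (-ContinuousLinearMap.mulLeftRight ℝ (H →L[ℝ] H) ↑B⁻¹ ↑B⁻¹) (1 + (s / 2) • A) := by
    rw [← hB]
    exact hasFDerivAt_ringInverse B
  have h3 := (((ContinuousLinearMap.apply ℝ H u).hasFDerivAt.comp_hasDerivAt s
    (h2.comp_hasDerivAt s h1)).const_smul (2 : ℝ)).sub_const u
  refine h3.congr_deriv ?_
  have hinv : (↑B⁻¹ : H →L[ℝ] H) = Ring.inverse (1 + (s / 2) • A) := by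
    rw [← hB, Ring.inverse_unit]
  simp [cayleyDeriv, cayleyMid, hinv, ContinuousLinearMap.mulLeftRight_apply, smul_smul]

theorem cayleyDeriv_add (hA : ∀ v, inner ℝ v (A v) = 0) (u : H) (s : ℝ) :
    cayleyDeriv A u s + (s / 2) • A (cayleyDeriv A u s) = -A (cayleyMid A u s) := by
  rw [cayleyDeriv, map_neg, smul_neg, ← neg_add, cayleyMid_add hA]

theorem norm_cayleyDeriv_le (hA : ∀ v, inner ℝ v (A v) = 0) (u : H) (s : ℝ) :
    ‖cayleyDeriv A u s‖ ≤ ‖A u‖ := by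
  refine (norm_le_norm_add_smul_skew hA (s / 2) _).trans ?_
  rw [cayleyDeriv_add hA, norm_neg]
  exact norm_apply_cayleyMid_le hA u s

/-- The velocity starts at `-A u` and drifts from it at most linearly in `s`. The deviation is
`(s/2) A` applied to a difference of two vectors, each of norm at most `‖A u‖`. -/
theorem norm_cayleyDeriv_add_le (hA : ∀ v, inner ℝ v (A v) = 0) (u : H) {s : ℝ} (hs : 0 ≤ s) :
    ‖cayleyDeriv A u s + A u‖ ≤ s * ‖A‖ * ‖A u‖ := by
  have h : cayleyDeriv A u s + A u
      = (s / 2) • A (A (cayleyMid A u s)) - (s / 2) • A (cayleyDeriv A u s) := by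
    have h1 := cayleyDeriv_add hA u s
    have h2 := congrArg A (cayleyMid_add hA u s)
    rw [map_add, map_smul] at h2
    rw [← h2, ← sub_eq_zero]
    rw [← sub_eq_zero] at h1
    rw [← h1]
    abel
  have hb : ∀ v, ‖v‖ ≤ ‖A u‖ → ‖(s / 2) • A v‖ ≤ s / 2 * (‖A‖ * ‖A u‖) := fun v hv => by
    rw [norm_smul, Real.norm_of_nonneg (by positivity)]
    exact mul_le_mul_of_nonneg_left
      ((A.le_opNorm v).trans (mul_le_mul_of_nonneg_left hv (norm_nonneg _))) (by positivity)
  rw [h]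
  refine (norm_sub_le _ _).trans ?_
  linarith [hb _ (norm_apply_cayleyMid_le hA u s), hb _ (norm_cayleyDeriv_le hA u s)]

end Cayley

/-! ### Cayley steps on the Stiefel manifold and decrease of the energy -/

variable {Ω : Set E3} {T : TetMesh Ω} {r N : ℕ}

theorem inner_skewOp_self (X Y V : Orbitals T r N) : inner ℝ V (skewOp X Y V) = 0 := by
  have h := inner_skewOp X Y V V
  rw [real_inner_comm] at h
  linarith

/-- Old and new points are `w ± (s/2) A w`; the cross terms in their Gram matrices cancel by
skewness, so these matrices are equal. -/
theorem cayley_mem_stiefel (X Y : Orbitals T r N) {U : Orbitals T r N} (hU : U ∈ stiefel T r N)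
    (s : ℝ) : cayley (skewOp X Y) U s ∈ stiefel T r N := by
  have hA := inner_skewOp_self X Y
  set A := skewOp X Y with hAdef
  have hU1 : gram U U = 1 := hU
  obtain ⟨w, hw1, hw2⟩ : ∃ w, w + (s / 2) • A w = U ∧ cayley A U s = w - (s / 2) • A w :=
    ⟨_, cayleyMid_add hA U s, cayley_eq_sub hA U s⟩
  change gram (cayley A U s) (cayley A U s) = 1
  rw [hw2, ← hU1, ← hw1]
  have h := gram_skewOp X Y w w
  rw [← hAdef] at h
  simp only [← gramₗ_apply] at h ⊢
  simp only [map_sub, map_add, map_smul, LinearMap.sub_apply, LinearMap.add_apply,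
    LinearMap.smul_apply, h]
  module

namespace KSSystem

variable {K : KSSystem}

theorem isSchemeSolution_iff {Δt : ℕ → ℝ} (hΔt : ∀ n, 0 < Δt n) {U : ℕ → Orbitals T r N} :
    K.IsSchemeSolution Δt U ↔
      ∀ n, U (n + 1) = cayley (skewOp (K.gradE (U n)) (U n)) (U n) (Δt n) :=
  forall_congr' fun n => midpoint_scheme_iff (inner_skewOp_self _ _) (hΔt n).ne'

theorem existsUnique_isSchemeSolution {Δt : ℕ → ℝ} (hΔt : ∀ n, 0 < Δt n) (U0 : Orbitals T r N) :
    ∃! U : ℕ → Orbitals T r N, U 0 = U0 ∧ K.IsSchemeSolution Δt U := by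
  refine ⟨fun n => Nat.rec U0 (fun k V => cayley (skewOp (K.gradE V) V) V (Δt k)) n,
    ⟨rfl, (isSchemeSolution_iff hΔt).2 fun n => rfl⟩, ?_⟩
  rintro V ⟨hV0, hV⟩
  funext n
  induction n with
  | zero => exact hV0
  | succ k ih => rw [(isSchemeSolution_iff hΔt).1 hV k, ih]

theorem hasDerivAt_energy_cayley (hdiff : ∀ U ∈ stiefel T r N, DifferentiableAt ℝ K.energy U)
    {U : Orbitals T r N} (hU : U ∈ stiefel T r N) (s : ℝ) :
    HasDerivAt (fun t => K.energy (cayley (skewOp (K.gradE U) U) U t))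
      (inner ℝ (K.gradE (cayley (skewOp (K.gradE U) U) U s))
        (cayleyDeriv (skewOp (K.gradE U) U) U s)) s :=
  (hdiff _ (cayley_mem_stiefel _ _ hU s)).hasGradientAt.hasFDerivAt.comp_hasDerivAt s
    (hasDerivAt_cayley (inner_skewOp_self _ _) U s)

theorem inner_gradE_skewOp {U : Orbitals T r N} (hU : U ∈ stiefel T r N)
    (hd : DifferentiableAt ℝ K.energy U) :
    inner ℝ (K.gradE U) (skewOp (K.gradE U) U U) = ‖K.gradG U‖ ^ 2 := by
  rw [← opA_eq_skewOp, opA_self hU hd, inner_gradE_gradG hU]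

/-- Local minimizers on the Stiefel manifold are critical points. -/
theorem gradG_eq_zero_of_isLocalMinOn
    (hdiff : ∀ U ∈ stiefel T r N, DifferentiableAt ℝ K.energy U) {U : Orbitals T r N}
    (hU : U ∈ stiefel T r N) (hmin : IsLocalMinOn K.energy (stiefel T r N) U) :
    K.gradG U = 0 := by
  have hA := inner_skewOp_self (K.gradE U) U
  have hd := hasDerivAt_energy_cayley hdiff hU 0
  have h0 := cayley_zero hA U
  have hcont : Tendsto (cayley (skewOp (K.gradE U) U) U) (𝓝 0) (𝓝[stiefel T r N] U) := by
    refine tendsto_nhdsWithin_iff.2 ⟨?_, Eventually.of_forall (cayley_mem_stiefel _ _ hU)⟩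
    have := (hasDerivAt_cayley hA U 0).continuousAt.tendsto
    rwa [h0] at this
  have hm : IsLocalMin (fun t => K.energy (cayley (skewOp (K.gradE U) U) U t)) 0 := by
    have := hcont.eventually hmin
    simpa only [IsLocalMin, IsMinFilter, h0] using this
  have h1 := hm.hasDerivAt_eq_zero hd
  -- At `s = 0` the bound on the drift of the velocity is zero.
  have h2 : cayleyDeriv (skewOp (K.gradE U) U) U 0 = -skewOp (K.gradE U) U U := by
    have h3 := norm_cayleyDeriv_add_le hA U le_rfl
    rw [zero_mul, zero_mul] at h3
    exact eq_neg_of_add_eq_zero_left (norm_le_zero_iff.1 h3)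
  rw [h0, h2, inner_neg_right, inner_gradE_skewOp hU (hdiff U hU), neg_eq_zero] at h1
  exact norm_eq_zero.1 (pow_eq_zero_iff two_ne_zero |>.1 h1)

/-- Sufficiently short Cayley steps decrease the energy. -/
theorem energy_cayley_le (hdiff : ∀ U ∈ stiefel T r N, DifferentiableAt ℝ K.energy U)
    {L : NNReal} (hLip : LipschitzOnWith L K.gradE (stiefel T r N)) {Γ : ℝ}
    {U : Orbitals T r N} (hU : U ∈ stiefel T r N) (hΓ : ‖K.gradE U‖ ≤ Γ) {τ : ℝ} (hτ : 0 ≤ τ)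
    (hτC : τ * (2 * √N * Γ + L) ≤ 1 / 2) :
    K.energy (cayley (skewOp (K.gradE U) U) U τ) ≤ K.energy U - τ / 2 * ‖K.gradG U‖ ^ 2 := by
  have hA := inner_skewOp_self (K.gradE U) U
  have hAU : skewOp (K.gradE U) U U = K.gradG U := by
    rw [← opA_eq_skewOp, opA_self hU (hdiff U hU)]
  have hGA := inner_gradE_skewOp hU (hdiff U hU)
  have hnA := norm_skewOp_gradE_le hU (hdiff U hU)
  -- The energy along the curve plus `s g² / 2` is shown to be nonincreasing on `[0, τ]`, where `g =
  -- ‖∇_G E(U)‖`.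
  have hderiv := fun s => (hasDerivAt_energy_cayley hdiff hU s).add
    ((hasDerivAt_id s).mul_const (‖K.gradG U‖ ^ 2 / 2))
  set g := ‖K.gradG U‖ with hg
  set A := skewOp (K.gradE U) U with hAdef
  have hanti : AntitoneOn ((fun s => K.energy (cayley A U s)) + fun s => id s * (g ^ 2 / 2))
      (Icc 0 τ) := by
    refine antitoneOn_of_deriv_nonpos (convex_Icc 0 τ)
      (fun s _ => (hderiv s).continuousAt.continuousWithinAt)
      (fun s _ => (hderiv s).differentiableAt.differentiableWithinAt) fun s hs => ?_
    rw [interior_Icc] at hs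
    rw [(hderiv s).deriv, one_mul]
    -- The slope splits into its initial value `-g²`, the error from the changing velocity and the
    -- error from the changing gradient. By `hτC` the two errors together are at most `g² / 2`.
    have e : inner ℝ (K.gradE (cayley A U s)) (cayleyDeriv A U s)
        = -inner ℝ (K.gradE U) (A U) + inner ℝ (K.gradE U) (cayleyDeriv A U s + A U)
          + inner ℝ (K.gradE (cayley A U s) - K.gradE U) (cayleyDeriv A U s) := by
      rw [inner_add_right, inner_sub_left]
      ring
    have b1 : inner ℝ (K.gradE U) (cayleyDeriv A U s + A U) ≤ Γ * (s * (2 * √N * g) * g) := by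
      refine (real_inner_le_norm _ _).trans (mul_le_mul hΓ ?_ (norm_nonneg _)
        ((norm_nonneg _).trans hΓ))
      refine (norm_cayleyDeriv_add_le hA U hs.1.le).trans ?_
      rw [hAU, ← hg]
      gcongr
      exact hs.1.le
    have b2 : inner ℝ (K.gradE (cayley A U s) - K.gradE U) (cayleyDeriv A U s)
        ≤ L * (s * g) * g := by
      have hn := norm_cayleyDeriv_le hA U s
      rw [hAU] at hn
      refine (real_inner_le_norm _ _).trans (mul_le_mul ?_ hn (norm_nonneg _)
        (mul_nonneg L.2 (mul_nonneg hs.1.le (norm_nonneg _))))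
      refine (hLip.norm_sub_le (cayley_mem_stiefel _ _ hU s) hU).trans ?_
      have := norm_cayley_sub_le hA U hs.1.le
      rw [hAU] at this
      exact mul_le_mul_of_nonneg_left this L.2
    have hC : 0 ≤ 2 * √N * Γ + L :=
      add_nonneg (mul_nonneg (by positivity) ((norm_nonneg _).trans hΓ)) L.2
    have b3 : s * (2 * √N * Γ + L) * g ^ 2 ≤ 1 / 2 * g ^ 2 :=
      mul_le_mul_of_nonneg_right
        ((mul_le_mul_of_nonneg_right hs.2.le hC).trans hτC) (sq_nonneg g)
    rw [e, hGA]
    nlinarith [b1, b2, b3]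
  have h := hanti (left_mem_Icc.2 hτ) (right_mem_Icc.2 hτ) hτ
  simp only [Pi.add_apply, id, cayley_zero hA, zero_mul, add_zero] at h
  linarith

end KSSystem

end KohnSham

/-! ### Convergence of descent sequences -/

/-- A sequence in a compact set along which `E` decreases by at least `t n / 2 * g ^ 2`, with
divergent `∑ t n`, minimizes `E` if the zeros of `g` are the minimizers of `E`. -/
theorem tendsto_of_descent {X : Type*} [MetricSpace X] {S : Set X} (hS : IsCompact S)
    {E g : X → ℝ} (hE : ContinuousOn E S) (hg : ContinuousOn g S) {e : ℝ}
    (he : ∀ V ∈ S, e ≤ E V) (hgE : ∀ V ∈ S, g V = 0 ↔ E V = e) {x : ℕ → X} (hx : ∀ n, x n ∈ S)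
    {t : ℕ → ℝ} (ht : ∀ n, 0 < t n)
    (hsum : Tendsto (fun n => ∑ i ∈ Finset.range n, t i) atTop atTop)
    (hdesc : ∀ n, E (x (n + 1)) ≤ E (x n) - t n / 2 * g (x n) ^ 2) :
    Tendsto (fun n => g (x n)) atTop (𝓝 0) ∧ Tendsto (fun n => E (x n)) atTop (𝓝 e) := by
  have hanti : Antitone fun n => E (x n) := antitone_nat_of_succ_le fun n =>
    (hdesc n).trans (sub_le_self _ (mul_nonneg (half_pos (ht n)).le (sq_nonneg _)))
  have hbdd : BddBelow (range fun n => E (x n)) :=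
    ⟨e, by rintro _ ⟨n, rfl⟩; exact he _ (hx n)⟩
  have hlim := tendsto_atTop_ciInf hanti hbdd
  set l := ⨅ n, E (x n) with hl
  have hlE : ∀ n, l ≤ E (x n) := fun n => ciInf_le hbdd n
  have hel : e ≤ l := le_ciInf fun n => he _ (hx n)
  have hle : l = e := by
    by_contra hne
    have hlt : e < l := lt_of_le_of_ne hel (Ne.symm hne)
    -- If the limit `l` exceeded `e`, then `g²` would have a positive minimum on the part of `S`
    -- where `E ≥ l`, which contains the sequence; summing the decreases would push the energy below
    -- `e`.
    have hK : IsCompact (S ∩ E ⁻¹' Ici l) :=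
      hS.of_isClosed_subset (hE.preimage_isClosed_of_isClosed hS.isClosed isClosed_Ici)
        inter_subset_left
    obtain ⟨p, hp, hpmin⟩ := hK.exists_isMinOn ⟨x 0, hx 0, hlE 0⟩
      ((hg.mono inter_subset_left).pow 2)
    have hc : 0 < g p ^ 2 := by
      refine sq_pos_of_ne_zero fun h => ?_
      have h1 : l ≤ E p := hp.2
      rw [(hgE p hp.1).1 h] at h1
      exact hlt.not_ge h1
    have hsumle : ∀ n, (∑ i ∈ Finset.range n, t i) * (g p ^ 2 / 2) ≤ E (x 0) - E (x n) := by
      intro n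
      induction n with
      | zero => simp
      | succ k ih =>
        have h1 : g p ^ 2 ≤ g (x k) ^ 2 := hpmin ⟨hx k, hlE k⟩
        have h2 := mul_le_mul_of_nonneg_left h1 (half_pos (ht k)).le
        rw [Finset.sum_range_succ, add_mul]
        linarith [hdesc k]
    obtain ⟨n, hn⟩ := ((hsum.atTop_mul_const (half_pos hc)).eventually_gt_atTop
      (E (x 0) - e)).exists
    linarith [hsumle n, he _ (hx n)]
  rw [hle] at hlim
  refine ⟨Metric.tendsto_atTop'.2 fun ε hε => ?_, hlim⟩
  -- Where `|g| ≥ ε` the energy has a minimum strictly above `e`, so the sequence eventually leaves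
  -- this set.
  have hK : IsCompact (S ∩ (fun V => |g V|) ⁻¹' Ici ε) :=
    hS.of_isClosed_subset (hg.abs.preimage_isClosed_of_isClosed hS.isClosed isClosed_Ici)
      inter_subset_left
  rcases (S ∩ (fun V => |g V|) ⁻¹' Ici ε).eq_empty_or_nonempty with hemp | hne
  · refine ⟨0, fun n _ => ?_⟩
    by_contra hn
    rw [Real.dist_0_eq_abs, not_lt] at hn
    exact (hemp ▸ (⟨hx n, hn⟩ : x n ∈ S ∩ (fun V => |g V|) ⁻¹' Ici ε) : x n ∈ (∅ : Set X))
  · obtain ⟨p, hp, hpmin⟩ := hK.exists_isMinOn hne (hE.mono inter_subset_left)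
    have hep : e < E p := by
      refine lt_of_le_of_ne (he p hp.1) fun h => ?_
      have h1 : ε ≤ |g p| := hp.2
      rw [(hgE p hp.1).2 h.symm, abs_zero] at h1
      exact hε.not_ge h1
    obtain ⟨n0, hn0⟩ := eventually_atTop.1 (hlim.eventually_lt_const hep)
    refine ⟨n0, fun n hn => ?_⟩
    by_contra hc
    rw [Real.dist_0_eq_abs, not_lt] at hc
    exact (hn0 n hn.le).not_ge (hpmin ⟨hx n, hc⟩)

namespace KohnSham

variable {Ω : Set E3} {T : TetMesh Ω} {r N : ℕ}

/-! ### The orbit of a local minimizer -/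

/-- The orbit of `U` under orthogonal transformations. -/
def orbit (U : Orbitals T r N) : Set (Orbitals T r N) :=
  {V | ∃ P ∈ Matrix.orthogonalGroup (Fin N) ℝ, V = rmul U P}

theorem self_mem_orbit (U : Orbitals T r N) : U ∈ orbit U := ⟨1, one_mem _, (rmul_one U).symm⟩

/-- Orthogonal transformations are isometries, so the rotation of `U` that is close to `V` can be
undone on `V`. This transfers local facts at `U` to its whole orbit. -/
theorem exists_rmul_of_infDist_orbit_lt {U V : Orbitals T r N} {ρ : ℝ}
    (h : Metric.infDist V (orbit U) < ρ) :
    ∃ P ∈ Matrix.orthogonalGroup (Fin N) ℝ, dist (rmul V P) U < ρ ∧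
      ∀ W, rmul V P ∈ orbit W → V ∈ orbit W := by
  obtain ⟨_, ⟨P, hP, rfl⟩, hd⟩ := (Metric.infDist_lt_iff ⟨U, self_mem_orbit U⟩).1 h
  have hPP : P * P.transpose = 1 := (Matrix.mem_orthogonalGroup_iff _ _).1 hP
  have hPP' : P.transpose * P = 1 := (Matrix.mem_orthogonalGroup_iff' _ _).1 hP
  have hPt : P.transpose ∈ Matrix.orthogonalGroup (Fin N) ℝ :=
    (Matrix.mem_orthogonalGroup_iff _ _).2 (by rw [Matrix.transpose_transpose, hPP'])
  refine ⟨P.transpose, hPt, ?_, ?_⟩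
  · have hU : rmul (rmul U P) P.transpose = U := by rw [rmul_rmul, hPP, rmul_one]
    rw [dist_eq_norm] at hd ⊢
    nth_rewrite 1 [← hU]
    rwa [← rmul_sub_left, norm_rmul_orthogonal _ hPt]
  · rintro W ⟨Q, hQ, hVQ⟩
    refine ⟨Q * P, mul_mem hQ hP, ?_⟩
    rw [← rmul_rmul, ← hVQ, rmul_rmul, hPP', rmul_one]

namespace KSSystem

variable {K : KSSystem}

/-- Near the orbit of a local minimizer that is isolated as a critical point up to orthogonal
transformations, the energy is minimal exactly on the orbit, and so are the critical points. -/
theorem exists_tube (hdiff : ∀ U ∈ stiefel T r N, DifferentiableAt ℝ K.energy U)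
    {Ustar : Orbitals T r N} (hmin : IsLocalMinOn K.energy (stiefel T r N) Ustar)
    (hiso : ∃ δc > 0, ∀ V ∈ Metric.closedBall Ustar δc ∩ stiefel T r N,
      K.gradG V = 0 → ∃ P ∈ Matrix.orthogonalGroup (Fin N) ℝ, V = rmul Ustar P) :
    ∃ ρ > 0, ∀ V ∈ stiefel T r N, Metric.infDist V (orbit Ustar) < ρ →
      K.energy Ustar ≤ K.energy V ∧ (K.gradG V = 0 ↔ K.energy V = K.energy Ustar) ∧
      (K.energy V = K.energy Ustar → V ∈ orbit Ustar) := by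
  obtain ⟨δc, hδc, hiso⟩ := hiso
  obtain ⟨ρ₁, hρ₁, hball⟩ := Metric.mem_nhdsWithin_iff.1 hmin
  have hle : ∀ V ∈ stiefel T r N, Metric.infDist V (orbit Ustar) < min ρ₁ δc →
      K.energy Ustar ≤ K.energy V := by
    intro V hV hd
    obtain ⟨P, hP, hdP, -⟩ := exists_rmul_of_infDist_orbit_lt hd
    rw [← K.energy_rmul V hP]
    exact hball ⟨hdP.trans_le (min_le_left _ _), rmul_mem_stiefel hV hP⟩
  have hcrit : ∀ V ∈ stiefel T r N, Metric.infDist V (orbit Ustar) < min ρ₁ δc →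
      K.gradG V = 0 → V ∈ orbit Ustar := by
    intro V hV hd h0
    obtain ⟨P, hP, hdP, horb⟩ := exists_rmul_of_infDist_orbit_lt hd
    refine horb _ (hiso _ ⟨(hdP.trans_le (min_le_right _ _)).le, rmul_mem_stiefel hV hP⟩ ?_)
    rw [gradG_rmul hV hP (hdiff _ (rmul_mem_stiefel hV hP)), h0, rmul_zero_left]
  have hmincrit : ∀ V ∈ stiefel T r N, Metric.infDist V (orbit Ustar) < min ρ₁ δc →
      K.energy V = K.energy Ustar → K.gradG V = 0 := by
    intro V hV hd hE
    refine gradG_eq_zero_of_isLocalMinOn hdiff hV ?_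
    -- The tube is open, so a point of it with energy `E(U*)` is itself a local minimizer on the
    -- manifold.
    have hopen : IsOpen {W | Metric.infDist W (orbit Ustar) < min ρ₁ δc} :=
      isOpen_lt (Metric.continuous_infDist_pt _) continuous_const
    filter_upwards [mem_nhdsWithin_of_mem_nhds (hopen.mem_nhds hd), self_mem_nhdsWithin]
      with W hW hWM
    rw [hE]
    exact hle W hWM hW
  refine ⟨min ρ₁ δc, lt_min hρ₁ hδc, fun V hV hd => ⟨hle V hV hd, ⟨fun h0 => ?_,
    hmincrit V hV hd⟩, fun hE => hcrit V hV hd (hmincrit V hV hd hE)⟩⟩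
  obtain ⟨P, hP, rfl⟩ := hcrit V hV hd h0
  exact K.energy_rmul _ hP

end KSSystem

end KohnSham

end

/-! ### Trapping near the orbit and convergence of the scheme -/

theorem mainTheorem1 {Ω : Set KohnSham.E3} (hΩ : IsOpen Ω) (T : KohnSham.TetMesh Ω) (r N : ℕ)
    (K : KohnSham.KSSystem)
    -- `E` is differentiable and `∇E` is Lipschitz continuous on the Stiefel manifold
    (hdiff : ∀ U ∈ KohnSham.stiefel T r N, DifferentiableAt ℝ K.energy U)
    (hLip : ∃ L : NNReal, LipschitzOnWith L K.gradE (KohnSham.stiefel T r N))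
    -- `Ustar` is a local minimizer
    (Ustar : KohnSham.Orbitals T r N) (hmem : Ustar ∈ KohnSham.stiefel T r N)
    (hmin : IsLocalMinOn K.energy (KohnSham.stiefel T r N) Ustar)
    -- and it is, up to rotation of the orbitals, an isolated critical point
    (hiso : ∃ δc > 0, ∀ V ∈ Metric.closedBall Ustar δc ∩ KohnSham.stiefel T r N,
      K.gradG V = 0 →
        ∃ P ∈ Matrix.orthogonalGroup (Fin N) ℝ, V = KohnSham.rmul Ustar P) :
    ∃ δ > 0, ∃ δT > 0,
      ∀ U0 ∈ Metric.closedBall Ustar δ ∩ KohnSham.stiefel T r N,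
      ∀ Δt : ℕ → ℝ, (∀ n, 0 < Δt n ∧ Δt n ≤ δT) →
        Filter.Tendsto (fun n => ∑ i ∈ Finset.range n, Δt i) Filter.atTop Filter.atTop →
        (∃! U : ℕ → KohnSham.Orbitals T r N, U 0 = U0 ∧ K.IsSchemeSolution Δt U) ∧
        ∀ U : ℕ → KohnSham.Orbitals T r N, U 0 = U0 → K.IsSchemeSolution Δt U →
          Filter.Tendsto (fun n => ‖K.gradG (U n)‖) Filter.atTop (nhds 0) ∧
          Filter.Tendsto (fun n => K.energy (U n)) Filter.atTop (nhds (K.energy Ustar)) := by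
  obtain ⟨L, hL⟩ := hLip
  obtain ⟨ρ, hρ, htube⟩ := KohnSham.KSSystem.exists_tube hdiff hmin hiso
  have hgradG : ContinuousOn K.gradG (KohnSham.stiefel T r N) :=
    KohnSham.KSSystem.continuousOn_gradG hL.continuousOn
  have hEc : ContinuousOn K.energy (KohnSham.stiefel T r N) := fun U hU =>
    (hdiff U hU).continuousAt.continuousWithinAt
  have hM := KohnSham.isCompact_stiefel (T := T) (r := r) (N := N)
  obtain ⟨Γ, hΓ⟩ := hM.exists_bound_of_continuousOn hL.continuousOn
  obtain ⟨Γ', hΓ'⟩ := hM.exists_bound_of_continuousOn hgradG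
  have hΓ0 : 0 ≤ Γ := (norm_nonneg _).trans (hΓ _ hmem)
  have hΓ0' : 0 ≤ Γ' := (norm_nonneg _).trans (hΓ' _ hmem)
  set O := KohnSham.orbit Ustar with hO
  set η := ρ / 2 with hη
  have hηpos : 0 < η := half_pos hρ
  have hdc : Continuous fun V => Metric.infDist V O := Metric.continuous_infDist_pt _
  -- Energy barrier: the shell `η/2 ≤ dist ≤ η` is compact, lies in the tube and misses the orbit.
  -- If it contains no point of the manifold, any `m` above `E(U*)` serves.
  obtain ⟨m, hm, hmE⟩ : ∃ m > K.energy Ustar, ∀ V ∈ KohnSham.stiefel T r N,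
      η / 2 ≤ Metric.infDist V O → Metric.infDist V O ≤ η → m ≤ K.energy V := by
    have hA : IsCompact (KohnSham.stiefel T r N ∩
        (fun V => Metric.infDist V O) ⁻¹' Icc (η / 2) η) :=
      hM.inter_right (isClosed_Icc.preimage hdc)
    rcases (KohnSham.stiefel T r N ∩
      (fun V => Metric.infDist V O) ⁻¹' Icc (η / 2) η).eq_empty_or_nonempty with hemp | hne
    · refine ⟨K.energy Ustar + 1, lt_add_one _, fun V hV h1 h2 => ?_⟩
      have hV' : V ∈ KohnSham.stiefel T r N ∩
        (fun V => Metric.infDist V O) ⁻¹' Icc (η / 2) η := ⟨hV, h1, h2⟩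
      rw [hemp] at hV'
      exact hV'.elim
    · obtain ⟨p, hp, hpmin⟩ := hA.exists_isMinOn hne (hEc.mono inter_subset_left)
      refine ⟨K.energy p, ?_, fun V hV h1 h2 => hpmin ⟨hV, h1, h2⟩⟩
      have hpd : Metric.infDist p O < ρ := hp.2.2.trans_lt (half_lt_self hρ)
      obtain ⟨h1, -, h3⟩ := htube p hp.1 hpd
      refine lt_of_le_of_ne h1 fun h => ?_
      have h0 := Metric.infDist_zero_of_mem (h3 h.symm)
      have h4 : η / 2 ≤ Metric.infDist p O := hp.2.1
      rw [hO, h0] at h4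
      linarith
  obtain ⟨δ₁, hδ₁, hball⟩ := Metric.eventually_nhds_iff.1
    ((hdiff Ustar hmem).continuousAt.eventually_lt_const hm)
  set C := 2 * √N * Γ + L with hC
  have hC0 : 0 ≤ C := add_nonneg (mul_nonneg (by positivity) hΓ0) L.2
  -- The start lies below the barrier energy and inside the shell. The first bound on the time step
  -- ensures `Δt C ≤ 1/2` for the energy decrease, the second a displacement of at most `η/2`; the
  -- `+ 1` keeps denominators positive.
  refine ⟨min (δ₁ / 2) (η / 4), by positivity,
    min (1 / (2 * (C + 1))) (η / (2 * (Γ' + 1))), by positivity, ?_⟩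
  rintro U0 ⟨hU0, hU0M⟩ Δt hΔt hsum
  have hpos : ∀ n, 0 < Δt n := fun n => (hΔt n).1
  refine ⟨KohnSham.KSSystem.existsUnique_isSchemeSolution hpos U0, fun U hU0' hU => ?_⟩
  have hstep := (KohnSham.KSSystem.isSchemeSolution_iff hpos).1 hU
  have hdesc : ∀ n, U n ∈ KohnSham.stiefel T r N →
      K.energy (U (n + 1)) ≤ K.energy (U n) - Δt n / 2 * ‖K.gradG (U n)‖ ^ 2 := by
    intro n hn
    rw [hstep n]
    refine KohnSham.KSSystem.energy_cayley_le hdiff hL hn (hΓ _ hn) (hpos n).le ?_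
    have h1 : Δt n ≤ 1 / (2 * (C + 1)) := (hΔt n).2.trans (min_le_left _ _)
    rw [le_div_iff₀ (by positivity)] at h1
    linarith [hpos n]
  have hjump : ∀ n, U n ∈ KohnSham.stiefel T r N → dist (U (n + 1)) (U n) ≤ η / 2 := by
    intro n hn
    have h1 := KohnSham.norm_cayley_sub_le
      (KohnSham.inner_skewOp_self (K.gradE (U n)) (U n)) (U n) (hpos n).le
    rw [← hstep n, ← KohnSham.KSSystem.opA_eq_skewOp, KohnSham.KSSystem.opA_self hn (hdiff _ hn)]
      at h1
    have h2 : Δt n ≤ η / (2 * (Γ' + 1)) := (hΔt n).2.trans (min_le_right _ _)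
    rw [le_div_iff₀ (by positivity)] at h2
    have h3 := mul_le_mul_of_nonneg_left (hΓ' _ hn) (hpos n).le
    rw [dist_eq_norm]
    linarith [hpos n]
  have hinv : ∀ n, U n ∈ KohnSham.stiefel T r N ∧ Metric.infDist (U n) O < η / 2 ∧
      K.energy (U n) < m := by
    intro n
    induction n with
    | zero =>
      rw [hU0']
      have hd : dist U0 Ustar ≤ min (δ₁ / 2) (η / 4) := hU0
      refine ⟨hU0M, ?_, hball ?_⟩
      · have h1 := Metric.infDist_le_dist_of_mem (x := U0) (KohnSham.self_mem_orbit Ustar)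
        linarith [hd.trans (min_le_right _ _)]
      · linarith [hd.trans (min_le_left _ _)]
    | succ k ih =>
      obtain ⟨hk, hkd, hkm⟩ := ih
      have hk1 : U (k + 1) ∈ KohnSham.stiefel T r N := by
        rw [hstep k]
        exact KohnSham.cayley_mem_stiefel _ _ hk _
      have hEk : K.energy (U (k + 1)) < m := by
        have h1 : 0 ≤ Δt k / 2 * ‖K.gradG (U k)‖ ^ 2 :=
          mul_nonneg (half_pos (hpos k)).le (sq_nonneg _)
        linarith [hdesc k hk]
      refine ⟨hk1, ?_, hEk⟩
      -- From distance below `η/2` a displacement of at most `η/2` stays within `η`; leaving the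
      -- inner region would mean landing in the shell, where the energy is at least `m`.
      by_contra hc
      have h1 : Metric.infDist (U (k + 1)) O ≤ Metric.infDist (U k) O + dist (U (k + 1)) (U k) :=
        Metric.infDist_le_infDist_add_dist
      exact hEk.not_ge (hmE _ hk1 (not_lt.1 hc) (by linarith [hjump k hk]))
  have hS : IsCompact (KohnSham.stiefel T r N ∩ (fun V => Metric.infDist V O) ⁻¹' Iic η) :=
    hM.inter_right (isClosed_Iic.preimage hdc)
  have hSρ : ∀ V ∈ KohnSham.stiefel T r N ∩ (fun V => Metric.infDist V O) ⁻¹' Iic η,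
      Metric.infDist V O < ρ := fun V hV =>
    lt_of_le_of_lt (show Metric.infDist V O ≤ η from hV.2) (half_lt_self hρ)
  exact tendsto_of_descent hS (hEc.mono inter_subset_left)
    (hgradG.mono inter_subset_left).norm (fun V hV => (htube V hV.1 (hSρ V hV)).1)
    (fun V hV => by rw [norm_eq_zero]; exact (htube V hV.1 (hSρ V hV)).2.1)
    (fun n => ⟨(hinv n).1, by
      have := (hinv n).2.1
      change Metric.infDist (U n) O ≤ η
      linarith⟩) hpos hsum fun n => hdesc n (hinv n).1
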